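/- For $C\ge 1$ and an integer $n\ge 1$ put $$K_n(C)=\sup\ \|R(\lambda,T)\|_{E\to E}\,\mathrm{dist}(\lambda,\sigma(T)),$$ where $R(\lambda,T)=(\lambda I-T)^{-1}$ and the supremum is taken over all normed spaces $E=(\mathbb{C}^n,|\cdot|)$ ($|\cdot|$ an arbitrary norm on $\mathbb{C}^n$), all linear operators $T:E\to E$ with $\|T^k\|_{E\to E}\le C$ for every integer $k\ge 0$, and all $\lambda\in\mathbb{C}\setminus\sigma(T)$ with $|\lambda|\ge 1$. Then: (i) for every integer $n\ge 1$ and every $C\ge 1$, $$K_n(C)\le C\left(\frac{5\pi}{3}+2\sqrt2\right)n^{3/2};$$ that is, $\|R(\lambda,T)\|\,\mathrm{dist}(\lambda,\sigma(T))\le C\left(\frac{5\pi}{3}+2\sqrt2\right)n^{3/2}$ for all such $E$, $T$ and $\lambda$; (ii) for every $C\ge 1$, $$\limsup_{n\to\infty} n^{-3/2}K_n(C)\le \frac{5C\pi}{3}.$$ -/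

import Mathlib

noncomputable section

namespace PowerBounded

/-- A norm on the complex vector space `ℂ^n`: a complex seminorm that vanishes only at `0`. -/
structure NormOn (n : ℕ) where
  toSeminorm : Seminorm ℂ (Fin n → ℂ)
  eq_zero : ∀ x, toSeminorm x = 0 → x = 0

/-- The normed space `(ℂ^n, N)`: the vector space `ℂ^n`, normed by `N` (this type synonym does not
see the sup norm of `Fin n → ℂ`). -/
def Space {n : ℕ} (_N : NormOn n) : Type := Fin n → ℂ

instance {n : ℕ} (N : NormOn n) : AddCommGroup (Space N) :=
  inferInstanceAs (AddCommGroup (Fin n → ℂ))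

instance {n : ℕ} (N : NormOn n) : Module ℂ (Space N) :=
  inferInstanceAs (Module ℂ (Fin n → ℂ))

instance {n : ℕ} (N : NormOn n) : Norm (Space N) := ⟨fun x => N.toSeminorm x⟩

theorem Space.core {n : ℕ} (N : NormOn n) : NormedSpace.Core ℂ (Space N) where
  norm_nonneg x := apply_nonneg N.toSeminorm x
  norm_smul c x := map_smul_eq_mul N.toSeminorm c x
  norm_triangle x y := map_add_le_add N.toSeminorm x y
  norm_eq_zero_iff x := ⟨N.eq_zero x, fun h => by rw [h]; exact map_zero N.toSeminorm⟩

instance {n : ℕ} (N : NormOn n) : NormedAddCommGroup (Space N) :=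
  NormedAddCommGroup.ofCore (Space.core N)

instance {n : ℕ} (N : NormOn n) : NormedSpace ℂ (Space N) :=
  NormedSpace.ofCore (Space.core N)

/-- `K n C` is the supremum of `‖R(z, T)‖ * dist(z, σ(T))` over all norms `N` on `ℂ^n`, all
operators `T` on `(ℂ^n, N)` with `‖T^k‖ ≤ C` for every `k`, and all complex `z` with `1 ≤ |z|`
outside the spectrum of `T`. It takes values in `[0, ∞]`. Here `resolvent T z = (z - T)⁻¹`, and
`‖ ‖` is the operator norm. -/
def K (n : ℕ) (C : ℝ) : ENNReal :=
  ⨆ (N : NormOn n) (T : Space N →L[ℂ] Space N) (_ : ∀ k : ℕ, ‖T ^ k‖ ≤ C)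
    (z : ℂ) (_ : 1 ≤ ‖z‖) (_ : z ∉ spectrum ℂ T),
    ENNReal.ofReal (‖resolvent T z‖ * Metric.infDist z (spectrum ℂ T))

end PowerBounded

end

noncomputable section

namespace PowerBounded

/-! ### The Hardy space as sequences, and the shift -/

open Polynomial

/-! The proof gives the stronger linear bound `8 * C * n`. Put `A = T/z`, with eigenvalues `μ` in
the closed disc at distance at least `d = dist(z, σ(T))/|z|` from 1. For `0 < ρ < 1` let `B` be the
Blaschke product with zeros `ρμ`. By Cayley–Hamilton `B(ρA) = 0`, so the difference quotient `a = (B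
- B(ρ))/(X - ρ)` gives `(1 - A)⁻¹ = ρ a(ρA)/B(ρ)`. Cauchy–Schwarz gives `‖a(ρA)‖ ≤ C‖a‖/√(1-ρ²)` in
the H² norm. As `|B| = 1` on the circle, `‖a‖ ≤ (1+|B(ρ)|)/√(1-ρ²)` (`exists_differenceQuotient`),
while `1/|B(ρ)|` is bounded factor by factor. Taking `1-ρ²` of order `d/n` finishes
(`radius_bound`). H² is modelled by ℓ², with multiplication by the variable as the shift. -/

/-- The Hilbert space of square-summable complex sequences. -/
abbrev SeqSpace : Type := lp (fun _ : ℕ => ℂ) 2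

theorem SeqSpace.summable_sq (a : SeqSpace) : Summable fun k => ‖a k‖ ^ (2 : ℕ) := by
  simpa using (lp.memℓp a).summable (by norm_num)

theorem SeqSpace.norm_sq_eq (a : SeqSpace) : ‖a‖ ^ 2 = ∑' k, ‖a k‖ ^ (2 : ℕ) := by
  simpa using lp.norm_rpow_eq_tsum (p := 2) (by norm_num) a

/-- Prepending a zero to a sequence. -/
def shiftFun (a : ℕ → ℂ) : ℕ → ℂ
  | 0 => 0
  | k + 1 => a k

theorem memℓp_shiftFun (a : SeqSpace) : Memℓp (shiftFun a) 2 := by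
  refine memℓp_gen ?_
  rw [← summable_nat_add_iff 1]
  simpa [shiftFun] using a.summable_sq

/-- The unilateral shift. -/
def shift : SeqSpace →ₗᵢ[ℂ] SeqSpace where
  toFun a := ⟨shiftFun a, memℓp_shiftFun a⟩
  map_add' a b := by
    ext k
    change shiftFun (⇑a + ⇑b) k = shiftFun a k + shiftFun b k
    cases k <;> simp [shiftFun]
  map_smul' c a := by
    ext k
    change shiftFun (c • ⇑a) k = c * shiftFun a k
    cases k <;> simp [shiftFun]
  norm_map' a := by
    rw [← sq_eq_sq₀ (norm_nonneg _) (norm_nonneg _), SeqSpace.norm_sq_eq, SeqSpace.norm_sq_eq,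
      (SeqSpace.summable_sq _).tsum_eq_zero_add]
    simp [shiftFun]

theorem shift_zero (a : SeqSpace) : shift a 0 = 0 := rfl

theorem shift_succ (a : SeqSpace) (k : ℕ) : shift a (k + 1) = a k := rfl

/-- The first basis vector. -/
def firstVec : SeqSpace := lp.single 2 0 1

theorem norm_firstVec : ‖firstVec‖ = 1 := by
  simp [firstVec]

theorem inner_firstVec_shift (a : SeqSpace) : inner ℂ firstVec (shift a) = 0 := by
  rw [firstVec, lp.inner_single_left, shift_zero, inner_zero_right]

/-! ### Functional calculus for power bounded elements -/

section Calculus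

variable {𝔸 : Type*} [NormedRing 𝔸] [NormedAlgebra ℂ 𝔸]

/-- Cauchy–Schwarz of `‖a k‖` against the geometric sequence `ρ ^ k`. -/
theorem weighted_sum_bound (A : 𝔸) {C ρ : ℝ} (hA : ∀ k : ℕ, ‖A ^ k‖ ≤ C) (h0 : 0 ≤ ρ)
    (h1 : ρ < 1) (a : SeqSpace) :
    Summable (fun k => ‖(a k * (ρ : ℂ) ^ k) • A ^ k‖) ∧
      ∑' k, ‖(a k * (ρ : ℂ) ^ k) • A ^ k‖ ≤ C / √(1 - ρ ^ 2) * ‖a‖ := by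
  have hC : 0 ≤ C := (norm_nonneg _).trans (hA 0)
  have hρ : ρ ^ 2 < 1 := by nlinarith
  have hgeo := summable_geometric_of_lt_one (sq_nonneg ρ) hρ
  have e1 : ∀ k : ℕ, (ρ ^ k) ^ 2 = (ρ ^ 2) ^ k := fun k => by rw [← pow_mul, ← pow_mul, mul_comm]
  obtain ⟨hs, hb⟩ := Real.summable_and_inner_le_Lp_mul_Lq_tsum_of_nonneg (p := 2) (q := 2)
    (Real.HolderConjugate.two_two) (f := fun k => ‖a k‖) (g := fun k => ρ ^ k)
    (fun _ => norm_nonneg _) (fun k => pow_nonneg h0 k)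
    (by simpa using a.summable_sq) (by simpa [e1] using hgeo)
  have hle : ∀ k, ‖(a k * (ρ : ℂ) ^ k) • A ^ k‖ ≤ C * (‖a k‖ * ρ ^ k) := fun k => by
    rw [norm_smul, norm_mul, norm_pow, Complex.norm_of_nonneg h0, mul_comm]
    gcongr
    exact hA k
  have hsum := Summable.of_nonneg_of_le (fun _ => norm_nonneg _) hle (hs.mul_left C)
  refine ⟨hsum, (hsum.tsum_le_tsum hle (hs.mul_left C)).trans ?_⟩
  rw [tsum_mul_left, div_mul_eq_mul_div, mul_div_assoc]
  refine mul_le_mul_of_nonneg_left (hb.trans_eq ?_) hC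
  simp only [Real.rpow_two, e1, tsum_geometric_of_lt_one (sq_nonneg ρ) hρ,
    ← SeqSpace.norm_sq_eq, ← Real.sqrt_eq_rpow, Real.sqrt_inv, Real.sqrt_sq (norm_nonneg a)]
  rw [div_eq_mul_inv]

variable [CompleteSpace 𝔸]

/-- The linear map `a ↦ ∑ aₖ (ρA)ᵏ` on square-summable sequences, for a power bounded `A`. -/
def weightedSum (A : 𝔸) {C ρ : ℝ} (hA : ∀ k : ℕ, ‖A ^ k‖ ≤ C) (h0 : 0 ≤ ρ) (h1 : ρ < 1) :
    SeqSpace →ₗ[ℂ] 𝔸 where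
  toFun a := ∑' k, (a k * (ρ : ℂ) ^ k) • A ^ k
  map_add' a b := by
    rw [← ((weighted_sum_bound A hA h0 h1 a).1.of_norm).tsum_add
      ((weighted_sum_bound A hA h0 h1 b).1.of_norm)]
    simp [add_mul, add_smul]
  map_smul' c a := by
    simp only [RingHom.id_apply]
    rw [← ((weighted_sum_bound A hA h0 h1 a).1.of_norm).tsum_const_smul c]
    simp [mul_assoc, mul_smul]

variable (A : 𝔸) {C ρ : ℝ} (hA : ∀ k : ℕ, ‖A ^ k‖ ≤ C) (h0 : 0 ≤ ρ) (h1 : ρ < 1)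

theorem norm_weightedSum_le (a : SeqSpace) :
    ‖weightedSum A hA h0 h1 a‖ ≤ C / √(1 - ρ ^ 2) * ‖a‖ :=
  (norm_tsum_le_tsum_norm (weighted_sum_bound A hA h0 h1 a).1).trans
    (weighted_sum_bound A hA h0 h1 a).2

theorem weightedSum_firstVec : weightedSum A hA h0 h1 firstVec = 1 := by
  change ∑' k, (firstVec k * (ρ : ℂ) ^ k) • A ^ k = 1
  rw [tsum_eq_single 0]
  · simp [firstVec]
  · intro k hk
    simp [firstVec, Pi.single_eq_of_ne hk]

theorem weightedSum_shift (a : SeqSpace) :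
    weightedSum A hA h0 h1 (shift a) = ((ρ : ℂ) • A) * weightedSum A hA h0 h1 a := by
  change ∑' k, (shift a k * (ρ : ℂ) ^ k) • A ^ k
    = ((ρ : ℂ) • A) * ∑' k, (a k * (ρ : ℂ) ^ k) • A ^ k
  rw [← ((weighted_sum_bound A hA h0 h1 a).1.of_norm).tsum_mul_left,
    ((weighted_sum_bound A hA h0 h1 (shift a)).1.of_norm).tsum_eq_zero_add]
  simp only [shift_zero, shift_succ, zero_mul, zero_smul, zero_add]
  refine tsum_congr fun k => ?_
  rw [smul_mul_smul_comm, ← pow_succ', pow_succ]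
  congr 1
  ring

theorem weightedSum_aeval_shift (p : ℂ[X]) (a : SeqSpace) :
    weightedSum A hA h0 h1 (aeval shift.toContinuousLinearMap p a)
      = aeval ((ρ : ℂ) • A) p * weightedSum A hA h0 h1 a := by
  induction p using Polynomial.induction_on generalizing a with
  | C c => simp [Algebra.algebraMap_eq_smul_one]
  | add p q hp hq => simp [hp, hq, add_mul]
  | monomial k c h =>
    have := h (shift a)
    rw [weightedSum_shift, ← mul_assoc] at this
    rw [pow_succ, ← mul_assoc, map_mul _ (_ * _), map_mul _ (_ * _), aeval_X, aeval_X]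
    exact this

end Calculus

/-! ### Blaschke products of an isometry -/

section Blaschke

variable {H : Type*} [NormedAddCommGroup H] [InnerProductSpace ℂ H] (S : H →ₗᵢ[ℂ] H)

/-- Operator form of `|ζ - w| = |1 - w̄ζ|` on the unit circle; both squares expand to the same
expression. -/
theorem norm_sub_smul_eq (w : ℂ) (x : H) : ‖S x - w • x‖ = ‖x - (star w) • S x‖ := by
  rw [← sq_eq_sq₀ (norm_nonneg _) (norm_nonneg _), norm_sub_sq (𝕜 := ℂ), norm_sub_sq (𝕜 := ℂ),
    norm_smul, norm_smul, norm_star, S.norm_map, inner_smul_right, inner_smul_right, ← inner_conj_symm]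
  simp only [RCLike.re_to_complex, Complex.mul_re, RCLike.star_def, Complex.conj_re,
    Complex.conj_im]
  ring

/-- The numerator of the Blaschke product with zeros `s`. -/
def blaschkeNum (s : Multiset ℂ) : ℂ[X] := (s.map fun w => X - Polynomial.C w).prod

/-- The denominator of the Blaschke product with zeros `s`. -/
def blaschkeDen (s : Multiset ℂ) : ℂ[X] := (s.map fun w => 1 - Polynomial.C (star w) * X).prod

theorem norm_aeval_blaschkeNum (s : Multiset ℂ) (x : H) :
    ‖aeval S.toContinuousLinearMap (blaschkeNum s) x‖
      = ‖aeval S.toContinuousLinearMap (blaschkeDen s) x‖ := by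
  induction s using Multiset.induction_on generalizing x with
  | empty => simp [blaschkeNum, blaschkeDen]
  | cons w s ih =>
    have e1 : blaschkeNum (w ::ₘ s) = (X - Polynomial.C w) * blaschkeNum s := by
      simp [blaschkeNum]
    have e2 : blaschkeDen (w ::ₘ s) = blaschkeDen s * (1 - Polynomial.C (star w) * X) := by
      rw [mul_comm]
      simp [blaschkeDen]
    have e3 : ∀ y, aeval S.toContinuousLinearMap (X - Polynomial.C w) y = S y - w • y := by
      intro y; simp [Algebra.algebraMap_eq_smul_one]
    have e4 : ∀ y, aeval S.toContinuousLinearMap (1 - Polynomial.C (star w) * X) y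
        = y - star w • S y := by
      intro y; simp [Algebra.algebraMap_eq_smul_one]
    have e5 := e4 (aeval S.toContinuousLinearMap (blaschkeNum s) x)
    rw [← mul_apply_eq_comp, ← map_mul, mul_comm, map_mul,
      mul_apply_eq_comp] at e5
    rw [e1, e2, map_mul, map_mul, mul_apply_eq_comp, mul_apply_eq_comp,
      e3, norm_sub_smul_eq, ← e5, ih]

theorem isUnit_one_sub_smul [CompleteSpace H] {w : ℂ} (hw : ‖w‖ < 1) :
    IsUnit (aeval S.toContinuousLinearMap (1 - Polynomial.C w * X)) := by
  have h : aeval S.toContinuousLinearMap (1 - Polynomial.C w * X)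
      = 1 - w • S.toContinuousLinearMap := by
    simp [Algebra.algebraMap_eq_smul_one]
  rw [h]
  refine isUnit_one_sub_of_norm_lt_one ?_
  rw [norm_smul]
  calc ‖w‖ * ‖S.toContinuousLinearMap‖ ≤ ‖w‖ * 1 := by
        gcongr; exact S.norm_toContinuousLinearMap_le
    _ < 1 := by simpa using hw

theorem isUnit_aeval_blaschkeDen [CompleteSpace H] {s : Multiset ℂ} (hs : ∀ w ∈ s, ‖w‖ < 1) :
    IsUnit (aeval S.toContinuousLinearMap (blaschkeDen s)) := by
  induction s using Multiset.induction_on with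
  | empty => simp [blaschkeDen]
  | cons w s ih =>
    have e2 : blaschkeDen (w ::ₘ s) = (1 - Polynomial.C (star w) * X) * blaschkeDen s := by
      simp [blaschkeDen]
    rw [e2, map_mul]
    exact (isUnit_one_sub_smul S (by simpa using hs w (by simp))).mul
      (ih fun v hv => hs v (by simp [hv]))

/-- If `e` is a unit vector orthogonal to the range of the isometry `S`, then `a`, the difference
quotient at `ρ` of the Blaschke product `N / D` applied to `e`, has norm at most
`(1 + |N(ρ) / D(ρ)|) / √(1 - ρ²)`; here `y = D(S)⁻¹ e`. -/
theorem exists_differenceQuotient [CompleteSpace H] {e : H} (he : ‖e‖ = 1)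
    (hS : ∀ x, inner ℂ e (S x) = 0) {s : Multiset ℂ} (hs : ∀ w ∈ s, ‖w‖ < 1) {ρ : ℝ}
    (h0 : 0 ≤ ρ) (h1 : ρ < 1) (hD : (blaschkeDen s).eval (ρ : ℂ) ≠ 0) :
    ∃ a y : H,
      aeval S.toContinuousLinearMap (X - Polynomial.C (ρ : ℂ)) a
        = aeval S.toContinuousLinearMap (blaschkeNum s) y -
          ((blaschkeNum s).eval (ρ : ℂ) / (blaschkeDen s).eval (ρ : ℂ)) • e ∧
      ‖a‖ ≤ (1 + ‖(blaschkeNum s).eval (ρ : ℂ) / (blaschkeDen s).eval (ρ : ℂ)‖)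
        / √(1 - ρ ^ 2) := by
  set N := blaschkeNum s
  set D := blaschkeDen s
  set β := N.eval (ρ : ℂ) / D.eval (ρ : ℂ) with hβ
  set M := aeval (R := ℂ) S.toContinuousLinearMap with hM
  have hρ : 0 < 1 - ρ ^ 2 := by nlinarith
  set L : ℂ[X] := 1 - Polynomial.C (ρ : ℂ) * X with hL
  obtain ⟨Q, hQ⟩ : (X - Polynomial.C (ρ : ℂ)) ∣ N - Polynomial.C β * D := by
    rw [dvd_iff_isRoot]
    simp [hβ, div_mul_cancel₀ _ hD]
  have hcomm : ∀ (p q : ℂ[X]) (x : H), M p (M q x) = M (p * q) x := fun p q x => by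
    rw [map_mul, mul_apply_eq_comp]
  have hLu : IsUnit (M L) := isUnit_one_sub_smul S (by simpa [abs_of_nonneg h0] using h1)
  obtain ⟨u, hu⟩ := (isUnit_aeval_blaschkeDen S hs).mul hLu
  -- Inverting `L` as well as `D` makes `D v` the Szegő kernel `(1 - ρS)⁻¹ e`.
  set v := (↑u⁻¹ : H →L[ℂ] H) e with hv
  have hv1 : M (D * L) v = e := by
    rw [map_mul, hv, ← mul_apply_eq_comp]
    rw [← hu, Units.mul_inv]; rfl
  have hLval : ∀ x, M L x = x - (ρ : ℂ) • S x := fun x => by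
    simp [hM, hL, Algebra.algebraMap_eq_smul_one]
  -- The isometry identity trades `1 - ρS` for `S - ρ`, which cancels the denominator of the
  -- quotient.
  have hnorm : ‖M Q (M L v)‖ = ‖M N v - β • M D v‖ := by
    have h := norm_sub_smul_eq S (ρ : ℂ) (M Q v)
    rw [show star (ρ : ℂ) = (ρ : ℂ) by simp, ← hLval, hcomm L Q, mul_comm, ← hcomm] at h
    rw [← h]
    congr 1
    have h2 : M (X - Polynomial.C (ρ : ℂ)) (M Q v) = S (M Q v) - (ρ : ℂ) • M Q v := by
      simp [hM, Algebra.algebraMap_eq_smul_one]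
    rw [← h2, hcomm, ← hQ]
    simp [hM, Algebra.algebraMap_eq_smul_one]
  -- An orthogonal decomposition, so Pythagoras yields the norm of the kernel.
  have hk : M D v = e + S ((ρ : ℂ) • M D v) := by
    have h := hLval (M D v)
    rw [hcomm, mul_comm, hv1] at h
    rw [map_smul, h]; abel
  have hkn : ‖M D v‖ ^ 2 * (1 - ρ ^ 2) = 1 := by
    have h : ‖M D v‖ ^ 2 = 1 + (ρ * ‖M D v‖) ^ 2 := by
      conv_lhs => rw [hk, norm_add_sq (𝕜 := ℂ), hS, S.norm_map, norm_smul, he]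
      simp [abs_of_nonneg h0]
    nlinarith
  have hkn' : ‖M D v‖ = 1 / √(1 - ρ ^ 2) := by
    rw [eq_div_iff (Real.sqrt_pos.2 hρ).ne', ← Real.sqrt_sq (norm_nonneg (M D v)),
      ← Real.sqrt_mul (sq_nonneg _), hkn, Real.sqrt_one]
  refine ⟨M Q (M L v), M L v, ?_, ?_⟩
  · rw [hcomm, ← hQ, ← hv1, ← hcomm D L]
    simp [hM, Algebra.algebraMap_eq_smul_one]
  · rw [hnorm]
    refine (norm_sub_le _ _).trans_eq ?_
    rw [norm_smul, norm_aeval_blaschkeNum, hkn']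
    ring

end Blaschke

/-! ### Bounding the inverse and choosing the radius -/

section ResolventBound

/-- Write `1 - ρ²μ = (1-μ) + (1-ρ²)μ` and use `1 ≤ |1-μ|/d`. This bounds the inverse of one Blaschke
factor at `ρ`. -/
theorem norm_one_sub_sq_mul_star_le {μ : ℂ} {d ρ : ℝ} (hd : 0 < d) (hμ : ‖μ‖ ≤ 1)
    (hμd : d ≤ ‖1 - μ‖) (h0 : 0 < ρ) (h1 : ρ < 1) :
    ‖1 - star ((ρ : ℂ) * μ) * ρ‖ ≤ ‖(ρ : ℂ) - ρ * μ‖ * (ρ⁻¹ * (1 + (1 - ρ ^ 2) / d)) := by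
  have hρ : 0 ≤ 1 - ρ ^ 2 := by nlinarith
  have e : 1 - star ((ρ : ℂ) * μ) * ρ = star ((1 - μ) + ((1 - ρ ^ 2 : ℝ) : ℂ) * μ) := by
    simp; ring
  have e2 : (ρ : ℂ) - ρ * μ = ρ * (1 - μ) := by ring
  rw [e, norm_star, e2, norm_mul, Complex.norm_of_nonneg h0.le]
  calc ‖(1 - μ) + ((1 - ρ ^ 2 : ℝ) : ℂ) * μ‖ ≤ ‖1 - μ‖ + (1 - ρ ^ 2) * 1 := by
        refine (norm_add_le _ _).trans ?_
        rw [norm_mul, Complex.norm_of_nonneg hρ]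
        gcongr
    _ ≤ ‖1 - μ‖ + (1 - ρ ^ 2) * (‖1 - μ‖ / d) := by
        gcongr
        rwa [le_div_iff₀ hd, one_mul]
    _ = _ := by field_simp

theorem norm_eval_blaschkeDen_le {s : Multiset ℂ} {d ρ : ℝ} (hd : 0 < d)
    (hs : ∀ μ ∈ s, ‖μ‖ ≤ 1 ∧ d ≤ ‖1 - μ‖) (h0 : 0 < ρ) (h1 : ρ < 1) :
    ‖(blaschkeDen (s.map ((ρ : ℂ) * ·))).eval (ρ : ℂ)‖
      ≤ ‖(blaschkeNum (s.map ((ρ : ℂ) * ·))).eval (ρ : ℂ)‖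
        * (ρ⁻¹ * (1 + (1 - ρ ^ 2) / d)) ^ s.card := by
  induction s using Multiset.induction_on with
  | empty => simp [blaschkeDen, blaschkeNum]
  | cons μ s ih =>
    have h := norm_one_sub_sq_mul_star_le hd (hs μ (by simp)).1 (hs μ (by simp)).2 h0 h1
    have h' := ih fun ν hν => hs ν (by simp [hν])
    have e1 : (blaschkeDen ((μ ::ₘ s).map ((ρ : ℂ) * ·))).eval (ρ : ℂ)
        = (1 - star ((ρ : ℂ) * μ) * ρ) * (blaschkeDen (s.map ((ρ : ℂ) * ·))).eval (ρ : ℂ) := by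
      simp [blaschkeDen]
    have e2 : (blaschkeNum ((μ ::ₘ s).map ((ρ : ℂ) * ·))).eval (ρ : ℂ)
        = ((ρ : ℂ) - ρ * μ) * (blaschkeNum (s.map ((ρ : ℂ) * ·))).eval (ρ : ℂ) := by
      simp [blaschkeNum]
    rw [e1, e2, norm_mul, norm_mul, Multiset.card_cons, pow_succ]
    refine (mul_le_mul h h' (norm_nonneg _) ((norm_nonneg _).trans h)).trans_eq ?_
    ring

theorem eval_blaschkeDen_ne_zero {s : Multiset ℂ} {ρ : ℝ} (hs : ∀ w ∈ s, ‖w‖ < 1) (h0 : 0 ≤ ρ)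
    (h1 : ρ < 1) : (blaschkeDen s).eval (ρ : ℂ) ≠ 0 := by
  rw [blaschkeDen, eval_multiset_prod, Multiset.map_map]
  refine Multiset.prod_ne_zero ?_
  simp only [Multiset.mem_map, not_exists, not_and]
  intro w hw h
  have h2 : (1 : ℂ) = star w * ρ := by simpa [sub_eq_zero] using h
  have h3 : (1 : ℝ) = ‖w‖ * ρ := by
    simpa [abs_of_nonneg h0] using congrArg norm h2
  nlinarith [hs w hw, norm_nonneg w]

variable {𝔸 : Type*} [NormedRing 𝔸] [NormedAlgebra ℂ 𝔸]

theorem aeval_smul_blaschkeNum (A : 𝔸) (c : ℂ) (s : Multiset ℂ) :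
    aeval (c • A) (blaschkeNum (s.map (c * ·))) = c ^ s.card • aeval A (blaschkeNum s) := by
  induction s using Multiset.induction_on with
  | empty => simp [blaschkeNum]
  | cons μ s ih =>
    have e1 : ∀ (μ : ℂ) (s : Multiset ℂ),
        blaschkeNum (μ ::ₘ s) = (X - Polynomial.C μ) * blaschkeNum s := by
      simp [blaschkeNum]
    have e2 : aeval (c • A) (X - Polynomial.C (c * μ)) = c • aeval A (X - Polynomial.C μ) := by
      simp [Algebra.algebraMap_eq_smul_one, smul_sub, smul_comm μ c]
    rw [Multiset.map_cons, e1, e1, map_mul, ih, e2, map_mul (aeval A), Multiset.card_cons, pow_succ,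
      mul_smul, mul_smul_comm, smul_mul_assoc]

theorem exists_one_sub_mul_eq_one [CompleteSpace 𝔸] {A : 𝔸} {C : ℝ} (hA : ∀ k : ℕ, ‖A ^ k‖ ≤ C)
    {s : Multiset ℂ} (hp : aeval A (blaschkeNum s) = 0) {d ρ : ℝ} (hd : 0 < d)
    (hs : ∀ μ ∈ s, ‖μ‖ ≤ 1 ∧ d ≤ ‖1 - μ‖) (h0 : 0 < ρ) (h1 : ρ < 1) :
    ∃ b : 𝔸, (1 - A) * b = 1 ∧
      ‖b‖ ≤ C * ρ / (1 - ρ ^ 2) * (1 + (ρ⁻¹ * (1 + (1 - ρ ^ 2) / d)) ^ s.card) := by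
  have hC : 0 ≤ C := (norm_nonneg _).trans (hA 0)
  have hρ : 0 < 1 - ρ ^ 2 := by nlinarith
  set s' := s.map ((ρ : ℂ) * ·) with hs'
  have hsn : ∀ w ∈ s', ‖w‖ < 1 := by
    simp only [hs', Multiset.mem_map]
    rintro _ ⟨μ, hμ, rfl⟩
    rw [norm_mul, Complex.norm_of_nonneg h0.le]
    nlinarith [(hs μ hμ).1, norm_nonneg μ]
  have hD := eval_blaschkeDen_ne_zero hsn h0.le h1
  have hle := norm_eval_blaschkeDen_le hd hs h0 h1
  obtain ⟨a, y, ha, han⟩ :=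
    exists_differenceQuotient shift norm_firstVec inner_firstVec_shift hsn h0.le h1 hD
  set β := (blaschkeNum s').eval (ρ : ℂ) / (blaschkeDen s').eval (ρ : ℂ) with hβ
  have hDpos := norm_pos_iff.2 hD
  have hN : (blaschkeNum s').eval (ρ : ℂ) ≠ 0 := by
    intro h
    rw [← hs', h, norm_zero, zero_mul] at hle
    exact hDpos.not_ge hle
  have hβ0 : β ≠ 0 := div_ne_zero hN hD
  have hβinv : ‖β‖⁻¹ ≤ (ρ⁻¹ * (1 + (1 - ρ ^ 2) / d)) ^ s.card := by
    rw [hβ, norm_div, inv_div, div_le_iff₀' (norm_pos_iff.2 hN)]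
    exact hle
  -- The calculus turns the shift into `ρA`; the Blaschke numerator then vanishes.
  have key := congrArg (weightedSum A hA h0.le h1) ha
  rw [map_sub (weightedSum A hA h0.le h1), map_smul (weightedSum A hA h0.le h1),
    weightedSum_aeval_shift, weightedSum_aeval_shift, weightedSum_firstVec,
    aeval_smul_blaschkeNum, hp, smul_zero, zero_mul, zero_sub] at key
  set F := weightedSum A hA h0.le h1 a
  refine ⟨((ρ : ℂ) / β) • F, ?_, ?_⟩
  · have h2 : (ρ : ℂ) • ((1 - A) * F) = β • (1 : 𝔸) := by
      rw [← neg_inj, ← key]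
      simp [Algebra.algebraMap_eq_smul_one, sub_mul, smul_sub]
    rw [mul_smul_comm, div_eq_inv_mul, mul_smul, h2, smul_smul, inv_mul_cancel₀ hβ0, one_smul]
  · rw [norm_smul, norm_div, Complex.norm_of_nonneg h0.le]
    have hF : ‖F‖ ≤ C * (1 + ‖β‖) / (1 - ρ ^ 2) := by
      refine (norm_weightedSum_le A hA h0.le h1 a).trans
        ((mul_le_mul_of_nonneg_left han (by positivity)).trans_eq ?_)
      rw [div_mul_div_comm, Real.mul_self_sqrt hρ.le]
    have hβp := norm_pos_iff.2 hβ0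
    calc ρ / ‖β‖ * ‖F‖ ≤ ρ / ‖β‖ * (C * (1 + ‖β‖) / (1 - ρ ^ 2)) := by gcongr
      _ = C * ρ / (1 - ρ ^ 2) * (1 + ‖β‖⁻¹) := by field_simp; ring
      _ ≤ _ := by gcongr

theorem radius_bound {n : ℕ} (hn : 1 ≤ n) {d : ℝ} (hd : 0 < d) (hd2 : d ≤ 2) :
    ∃ ρ : ℝ, 0 < ρ ∧ ρ < 1 ∧
      ρ / (1 - ρ ^ 2) * (1 + (ρ⁻¹ * (1 + (1 - ρ ^ 2) / d)) ^ n) * d ≤ 8 * n := by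
  have hn' : (1 : ℝ) ≤ n := by exact_mod_cast hn
  have hn0 : (0 : ℝ) < n := by linarith
  -- With `1-ρ² = td`, the quantity to bound is at most `(1 + e^(9/10))/t`, and `1 + 5/2 ≤ 8 *
  -- (9/20)`.
  set t : ℝ := 9 / (20 * n) with ht
  have ht0 : 0 < t := by positivity
  have htn : t * n = 9 / 20 := by rw [ht]; field_simp
  have ht1 : t ≤ 9 / 20 := by nlinarith
  have hpos : 0 < 1 - t * d := by nlinarith
  set ρ := √(1 - t * d) with hρ
  have hsq : ρ ^ 2 = 1 - t * d := Real.sq_sqrt hpos.le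
  have h0 : 0 < ρ := Real.sqrt_pos.2 hpos
  have h1 : ρ < 1 := by
    have : 0 < t * d := by positivity
    nlinarith
  have hexp : Real.exp (9 / 10) ≤ 5 / 2 := by
    have h := Real.exp_one_lt_d9
    have h2 : Real.exp 1 = Real.exp (9 / 10) * Real.exp (1 / 10) := by
      rw [← Real.exp_add]; norm_num
    have h3 := Real.add_one_le_exp (1 / 10 : ℝ)
    nlinarith [Real.exp_pos (9 / 10)]
  have hA : (1 + t) ^ n ≤ Real.exp (9 / 20) := by
    calc (1 + t) ^ n ≤ Real.exp t ^ n := by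
          gcongr; linarith [Real.add_one_le_exp t]
      _ = Real.exp (9 / 20) := by rw [← Real.exp_nat_mul, mul_comm, htn]
  -- The prefactor `ρ` cancels one `ρ⁻¹`. The remaining power `n - 1` is what makes the exponent
  -- `2tm/(1-2t)` at most `9/10`.
  obtain ⟨m, rfl⟩ : ∃ m, n = m + 1 := ⟨n - 1, by omega⟩
  have hB : ρ⁻¹ ^ m ≤ Real.exp (9 / 20) := by
    have hq : 0 < 1 - 2 * t := by linarith
    have h2 : ρ⁻¹ ^ 2 ≤ Real.exp (2 * t / (1 - 2 * t)) := by
      rw [inv_pow, hsq]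
      calc (1 - t * d)⁻¹ ≤ (1 - 2 * t)⁻¹ := by gcongr 1; nlinarith
        _ = 2 * t / (1 - 2 * t) + 1 := by field_simp; ring
        _ ≤ _ := Real.add_one_le_exp _
    rw [← sq_le_sq₀ (by positivity) (by positivity), ← pow_mul, mul_comm, pow_mul]
    calc (ρ⁻¹ ^ 2) ^ m ≤ Real.exp (2 * t / (1 - 2 * t)) ^ m := by gcongr
      _ = Real.exp (m * (2 * t / (1 - 2 * t))) := by rw [← Real.exp_nat_mul]
      _ ≤ Real.exp (2 * (9 / 20)) := by
          refine Real.exp_le_exp.2 ?_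
          push_cast at htn
          rw [mul_div_assoc', div_le_iff₀ hq]
          nlinarith
      _ = _ := by rw [← Real.exp_nat_mul]; norm_num
  refine ⟨ρ, h0, h1, ?_⟩
  have e : 1 - ρ ^ 2 = t * d := by rw [hsq]; ring
  have e2 : ρ / (t * d) * (1 + (ρ⁻¹ * (1 + t)) ^ (m + 1)) * d
      = (ρ + ρ⁻¹ ^ m * (1 + t) ^ (m + 1)) / t := by
    rw [mul_pow, pow_succ ρ⁻¹]
    field_simp
  rw [e, mul_div_cancel_right₀ _ hd.ne', e2, div_le_iff₀ ht0, mul_assoc, mul_comm _ t, htn]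
  have h3 : ρ⁻¹ ^ m * (1 + t) ^ (m + 1) ≤ 5 / 2 := by
    refine (mul_le_mul hB hA (by positivity) (by positivity)).trans ?_
    rw [← Real.exp_add]
    norm_num at hexp ⊢
    exact hexp
  linarith

end ResolventBound

/-! ### Spectral data and the linear resolvent bound -/

section Operators

variable {E : Type*} [NormedAddCommGroup E] [NormedSpace ℂ E]

theorem mem_spectrum_of_apply_eq_smul {T : E →L[ℂ] E} {μ : ℂ} {v : E} (hv : v ≠ 0)
    (h : T v = μ • v) : μ ∈ spectrum ℂ T := by
  rw [spectrum.mem_iff]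
  rintro ⟨u, hu⟩
  apply hv
  have h2 : (u : E →L[ℂ] E) v = 0 := by
    simp [hu, h, Algebra.algebraMap_eq_smul_one]
  calc v = ((↑u⁻¹ : E →L[ℂ] E) * u) v := by simp
    _ = 0 := by rw [mul_apply_eq_comp, h2, map_zero]

theorem norm_le_one_of_apply_eq_smul {T : E →L[ℂ] E} {C : ℝ} (hT : ∀ k : ℕ, ‖T ^ k‖ ≤ C) {μ : ℂ}
    {v : E} (hv : v ≠ 0) (h : T v = μ • v) : ‖μ‖ ≤ 1 := by
  by_contra! hμ
  have hk : ∀ k : ℕ, (T ^ k) v = μ ^ k • v := by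
    intro k
    induction k with
    | zero => simp
    | succ k ih => rw [pow_succ, mul_apply_eq_comp, h, map_smul, ih, smul_smul, pow_succ']
  obtain ⟨k, hC⟩ := pow_unbounded_of_one_lt C hμ
  have h2 := (T ^ k).le_of_opNorm_le (hT k) v
  rw [hk, norm_smul, norm_pow] at h2
  exact hC.not_ge (le_of_mul_le_mul_right h2 (norm_pos_iff.2 hv))

variable [FiniteDimensional ℂ E]

theorem exists_multiset_annihilating (T : E →L[ℂ] E) :
    ∃ s : Multiset ℂ, s.card = Module.finrank ℂ E ∧ aeval T (blaschkeNum s) = 0 ∧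
      ∀ μ ∈ s, ∃ v : E, v ≠ 0 ∧ T v = μ • v := by
  set f : E →ₗ[ℂ] E := T.toLinearMap with hf
  have hsplit := IsAlgClosed.splits f.charpoly
  have hprod : blaschkeNum f.charpoly.roots = f.charpoly :=
    (hsplit.eq_prod_roots_of_monic f.charpoly_monic).symm
  refine ⟨f.charpoly.roots, ?_, ?_, ?_⟩
  · rw [← hsplit.natDegree_eq_card_roots, f.charpoly_natDegree]
  · rw [hprod]
    have h : ∀ p : ℂ[X], ((aeval T p : E →L[ℂ] E) : E →ₗ[ℂ] E) = aeval f p := fun p =>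
      by
      induction p using Polynomial.induction_on with
      | C c => ext; simp [Algebra.algebraMap_eq_smul_one]
      | add p q hp hq => rw [map_add, map_add, ← hp, ← hq]; rfl
      | monomial k c hk =>
        rw [pow_succ, ← mul_assoc, map_mul _ (_ * _), map_mul _ (_ * _), ← hk, aeval_X, aeval_X]
        rfl
    ext x
    have := congrArg (fun g : E →ₗ[ℂ] E => g x) ((h f.charpoly).trans f.aeval_self_charpoly)
    exact this
  · intro μ hμ
    have h : Module.End.HasEigenvalue f μ :=
      (Module.End.hasEigenvalue_iff_isRoot_charpoly f μ).2 (isRoot_of_mem_roots hμ)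
    obtain ⟨v, hv⟩ := h.exists_hasEigenvector
    exact ⟨v, hv.2, hv.apply_eq_smul⟩

/-- On a space of dimension `n`, an operator with powers bounded by `C` satisfies
`‖(z - T)⁻¹‖ dist(z, σ(T)) ≤ 8 C n` for `|z| ≥ 1`. -/
theorem norm_resolvent_mul_infDist_le (hE : 1 ≤ Module.finrank ℂ E) {T : E →L[ℂ] E} {C : ℝ}
    (hT : ∀ k : ℕ, ‖T ^ k‖ ≤ C) {z : ℂ} (hz : 1 ≤ ‖z‖) (hzT : z ∉ spectrum ℂ T) :
    ‖resolvent T z‖ * Metric.infDist z (spectrum ℂ T) ≤ 8 * C * Module.finrank ℂ E := by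
  have : CompleteSpace E := FiniteDimensional.complete ℂ E
  have hC : 0 ≤ C := (norm_nonneg _).trans (hT 0)
  have hz0 : z ≠ 0 := norm_pos_iff.1 (by linarith)
  have hzp : 0 < ‖z‖ := by linarith
  obtain ⟨s, hcard, hann, hs⟩ := exists_multiset_annihilating T
  rcases (Metric.infDist_nonneg (x := z) (s := spectrum ℂ T)).eq_or_lt with hd | hd
  · rw [← hd, mul_zero]; positivity
  set D := Metric.infDist z (spectrum ℂ T)
  have hD : ∀ μ ∈ s, D ≤ ‖z - μ‖ := fun μ hμ => by
    obtain ⟨v, hv, h⟩ := hs μ hμ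
    rw [← dist_eq_norm]
    exact Metric.infDist_le_dist_of_mem (mem_spectrum_of_apply_eq_smul hv h)
  have hA : ∀ k : ℕ, ‖(z⁻¹ • T) ^ k‖ ≤ C := fun k => by
    rw [_root_.smul_pow, norm_smul, norm_pow, norm_inv]
    calc ‖z‖⁻¹ ^ k * ‖T ^ k‖ ≤ 1 * ‖T ^ k‖ := by
          gcongr; exact pow_le_one₀ (by positivity) (inv_le_one_of_one_le₀ hz)
      _ ≤ C := by simpa using hT k
  have hann' : aeval (z⁻¹ • T) (blaschkeNum (s.map (z⁻¹ * ·))) = 0 :=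
    (aeval_smul_blaschkeNum T z⁻¹ s).trans (by rw [hann, smul_zero])
  have hs' : ∀ μ ∈ s.map (z⁻¹ * ·), ‖μ‖ ≤ 1 ∧ D / ‖z‖ ≤ ‖1 - μ‖ := by
    simp only [Multiset.mem_map]
    rintro _ ⟨μ, hμ, rfl⟩
    obtain ⟨v, hv, h⟩ := hs μ hμ
    constructor
    · rw [norm_mul, norm_inv]
      exact mul_le_one₀ (inv_le_one_of_one_le₀ hz) (norm_nonneg _)
        (norm_le_one_of_apply_eq_smul hT hv h)
    · rw [show 1 - z⁻¹ * μ = (z - μ) / z by field_simp, norm_div]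
      gcongr
      exact hD μ hμ
  have hd' : 0 < D / ‖z‖ := div_pos hd hzp
  have hd2 : D / ‖z‖ ≤ 2 := by
    obtain ⟨μ, hμ⟩ : ∃ μ, μ ∈ s.map (z⁻¹ * ·) :=
      Multiset.card_pos_iff_exists_mem.1 (by rw [Multiset.card_map]; omega)
    obtain ⟨h1, h2⟩ := hs' μ hμ
    refine h2.trans ((norm_sub_le _ _).trans ?_)
    rw [norm_one]; linarith
  obtain ⟨ρ, h0, h1, hb⟩ := radius_bound hE hd' hd2
  obtain ⟨b, hb1, hb2⟩ := exists_one_sub_mul_eq_one hA hann' hd' hs' h0 h1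
  -- A right inverse suffices, since `z - T` is already a unit.
  have hres : resolvent T z = z⁻¹ • b := by
    have hu : IsUnit (algebraMap ℂ (E →L[ℂ] E) z - T) := by
      simpa [spectrum.mem_iff] using hzT
    have h2 : (algebraMap ℂ (E →L[ℂ] E) z - T) * (z⁻¹ • b) = 1 := by
      rw [mul_smul_comm, ← smul_mul_assoc, smul_sub, Algebra.algebraMap_eq_smul_one, smul_smul,
        inv_mul_cancel₀ hz0, one_smul, hb1]
    rw [resolvent, ← mul_one (Ring.inverse _), ← h2, ← mul_assoc, Ring.inverse_mul_cancel _ hu,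
      one_mul]
  rw [Multiset.card_map, hcard] at hb2
  rw [hres, norm_smul, norm_inv]
  calc ‖z‖⁻¹ * ‖b‖ * D = ‖b‖ * (D / ‖z‖) := by ring
    _ ≤ _ := mul_le_mul_of_nonneg_right hb2 hd'.le
    _ = C * _ := by rw [mul_div_assoc, mul_assoc, mul_assoc, ← mul_assoc (ρ / _)]
    _ ≤ C * (8 * Module.finrank ℂ E) := mul_le_mul_of_nonneg_left hb hC
    _ = _ := by ring

end Operators

end PowerBounded

/-! ### Passage to the supremum and comparison of constants -/

namespace PowerBounded

theorem K_le {n : ℕ} (hn : 1 ≤ n) (C : ℝ) : K n C ≤ ENNReal.ofReal (8 * C * n) := by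
  refine iSup_le fun N => iSup_le fun T => iSup_le fun hT => iSup_le fun z => iSup_le fun hz =>
    iSup_le fun hzT => ENNReal.ofReal_le_ofReal ?_
  have hrank : Module.finrank ℂ (Space N) = n := Module.finrank_fin_fun ℂ
  have : FiniteDimensional ℂ (Space N) := inferInstanceAs (FiniteDimensional ℂ (Fin n → ℂ))
  have h := norm_resolvent_mul_infDist_le (by rw [hrank]; exact hn) hT hz hzT
  rwa [hrank] at h

theorem eight_le_const : 8 ≤ 5 * Real.pi / 3 + 2 * √2 := by
  have h1 := Real.pi_gt_d2
  have h2 : (1.41 : ℝ) ≤ √2 := Real.le_sqrt_of_sq_le (by norm_num)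
  linarith

end PowerBounded

end

theorem mainTheorem1 (C : ℝ) (hC : 1 ≤ C) :
    (∀ n : ℕ, 1 ≤ n →
      PowerBounded.K n C ≤
        ENNReal.ofReal (C * (5 * Real.pi / 3 + 2 * Real.sqrt 2) * (n : ℝ) ^ (3 / 2 : ℝ))) ∧
    Filter.limsup
        (fun n : ℕ => ENNReal.ofReal ((n : ℝ) ^ (-(3 / 2) : ℝ)) * PowerBounded.K n C)
        Filter.atTop ≤
      ENNReal.ofReal (5 * C * Real.pi / 3) := by
  constructor
  · intro n hn
    have hn' : (1 : ℝ) ≤ n := by exact_mod_cast hn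
    refine (PowerBounded.K_le hn C).trans (ENNReal.ofReal_le_ofReal ?_)
    rw [mul_comm 8 C]
    have h := PowerBounded.eight_le_const
    have h2 : (n : ℝ) ≤ (n : ℝ) ^ (3 / 2 : ℝ) := by
      simpa using Real.rpow_le_rpow_of_exponent_le hn' (by norm_num : (1 : ℝ) ≤ 3 / 2)
    gcongr
  -- The linear bound leaves `8C n^(-1/2)` after normalisation, so the limsup is in fact 0.
  · have hlim : Filter.Tendsto
        (fun n : ℕ => ENNReal.ofReal (8 * C * (n : ℝ) ^ (-(1 / 2) : ℝ))) Filter.atTop (nhds 0) := by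
      have h := ((tendsto_rpow_neg_atTop (by norm_num : (0 : ℝ) < 1 / 2)).comp
        tendsto_natCast_atTop_atTop).const_mul (8 * C)
      simpa using ENNReal.tendsto_ofReal h
    refine le_trans ?_ zero_le
    rw [← hlim.limsup_eq]
    refine Filter.limsup_le_limsup ?_
    filter_upwards [Filter.eventually_ge_atTop 1] with n hn
    have hn' : (0 : ℝ) < n := by exact_mod_cast hn
    refine (mul_le_mul_right (PowerBounded.K_le hn C) _).trans_eq ?_
    rw [← ENNReal.ofReal_mul (by positivity), mul_left_comm, ← Real.rpow_add_one hn'.ne']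
    norm_num
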